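/- Let $G$ be a finite group with Fitting subgroup $F(G)$ (the largest nilpotent normal subgroup). Let $\nu_1(G)$ be the smallest normal subgroup $N$ of $F(G)$ such that $F(G)/N$ is a direct product of elementary abelian groups that is centralized by $F(G)$. Let $\ell = |F(G)/\nu_1(G)|$ be the $F$-rank of $G$, and let $k$ be the product of the distinct primes dividing $\ell$ (so $k=1$ if $\ell=1$). Let $n$ be a natural number and let $F$ be a free group on $n$ generators. For an epimorphism $\mu : F \to G$ put $R = \ker\mu$ and $L = \mu^{-1}(F(G))$. For a positive integer $m$ let $R^m$ be the subgroup generated by the $m$-th powers of the elements of $R$. Define, for each prime $p$, $$G^*_p(\mu) = F/[R,L]R^p \qquad\text{and}\qquad G^*(\mu) = F/[R,L]R^k .$$ Then for any two epimorphisms $\mu_1,\mu_2 : F \to G$: 1. $G^*_p(\mu_1) \cong G^*_p(\mu_2)$ for every prime $p$ (in particular for every prime $p$ dividing $\ell$); 2. $G^*(\mu_1) \cong G^*(\mu_2)$. That is, the isomorphism type of the $p$-covering group depends only on $G$, $n$ and $p$, and that of the covering group depends only on $G$ and $n$, but not on the epimorphism. -/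

import Mathlib

/-- The Fitting subgroup: generated by all nilpotent normal subgroups. In a finite group it is
the largest nilpotent normal subgroup. -/
def fittingSubgroup (G : Type*) [Group G] : Subgroup G :=
  sSup {N : Subgroup G | N.Normal ∧ Group.IsNilpotent N}

instance fittingSubgroup_normal (G : Type*) [Group G] : (fittingSubgroup G).Normal :=
  Subgroup.sSup_normal _ (fun _ hN => hN.1)

/-- `Q` is a finite direct product of elementary abelian groups, that is, of cyclic groups
of prime order (the primes may differ, and the product may be empty). -/
def IsProdElementaryAbelian (Q : Type*) [Group Q] : Prop :=
  ∃ (m : ℕ) (p : Fin m → ℕ), (∀ i, (p i).Prime) ∧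
    Nonempty (Q ≃* Multiplicative (∀ i, ZMod (p i)))

/-- `N ≤ A` is a normal subgroup of the Fitting subgroup such that `A / N` is a direct product of
elementary abelian groups that is centralized by the Fitting subgroup. -/
def IsFCentralStep {G : Type*} [Group G] (A N : Subgroup G) : Prop :=
  N ≤ A ∧ N ≤ fittingSubgroup G ∧ (N.subgroupOf (fittingSubgroup G)).Normal ∧
    (∃ _ : (N.subgroupOf A).Normal, IsProdElementaryAbelian (A ⧸ N.subgroupOf A)) ∧
    ⁅fittingSubgroup G, A⁆ ≤ N

/-- The `F`-central series `ν₀(G) ≥ ν₁(G) ≥ …`: `ν₀(G)` is the Fitting subgroup, and `νᵢ₊₁(G)` is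
the smallest subgroup `N` with `IsFCentralStep (νᵢ(G)) N`. -/
def fCentralSeries (G : Type*) [Group G] : ℕ → Subgroup G
  | 0 => fittingSubgroup G
  | i + 1 => sInf {N : Subgroup G | IsFCentralStep (fCentralSeries G i) N}

/-- The `F`-rank `|ν₀(G) / ν₁(G)|`. -/
noncomputable def fRank (G : Type*) [Group G] : ℕ :=
  (fCentralSeries G 1).relIndex (fCentralSeries G 0)

/-- The core of `m`: the product of the distinct primes that divide `m`. -/
def natCore (m : ℕ) : ℕ := ∏ p ∈ m.primeFactors, p

/-- `R ^ m`: the subgroup generated by the `m`-th powers of the elements of `R`. -/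
def powerSubgroup {F : Type*} [Group F] (R : Subgroup F) (m : ℕ) : Subgroup F :=
  Subgroup.closure {y | ∃ x ∈ R, y = x ^ m}

instance powerSubgroup_normal {F : Type*} [Group F] (R : Subgroup F) [hR : R.Normal] (m : ℕ) :
    (powerSubgroup R m).Normal := by
  have h : Group.conjugatesOfSet {y | ∃ x ∈ R, y = x ^ m} = {y | ∃ x ∈ R, y = x ^ m} := by
    refine Set.Subset.antisymm ?_ Group.subset_conjugatesOfSet
    intro z hz
    obtain ⟨y, ⟨x, hx, rfl⟩, hyz⟩ := Group.mem_conjugatesOfSet_iff.1 hz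
    obtain ⟨c, rfl⟩ := isConj_iff.1 hyz
    exact ⟨c * x * c⁻¹, hR.conj_mem x hx c, conj_pow.symm⟩
  have h2 : powerSubgroup R m = Subgroup.normalClosure {y | ∃ x ∈ R, y = x ^ m} := by
    rw [Subgroup.normalClosure, h, powerSubgroup]
  rw [h2]
  infer_instance

/-- For `μ : F → G` with kernel `R`, and `L` the full preimage of the Fitting subgroup of `G`,
the subgroup `[R, L] R ^ m` of `F`. -/
def coverKernel {F G : Type*} [Group F] [Group G] (μ : F →* G) (m : ℕ) : Subgroup F :=
  ⁅μ.ker, (fittingSubgroup G).comap μ⁆ ⊔ powerSubgroup μ.ker m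

instance coverKernel_normal {F G : Type*} [Group F] [Group G] (μ : F →* G) (m : ℕ) :
    (coverKernel μ m).Normal := by
  unfold coverKernel
  infer_instance

/-- The `p`-covering group `F / [R, L] R ^ p` associated with `μ`. -/
abbrev PCoveringGroup {F G : Type*} [Group F] [Group G] (μ : F →* G) (p : ℕ) : Type _ :=
  F ⧸ coverKernel μ p

/-- The covering group `F / [R, L] R ^ k` associated with `μ`, where `k` is the core of the
`F`-rank of `G`. -/
abbrev CoveringGroup {F G : Type*} [Group F] [Group G] (μ : F →* G) : Type _ :=
  F ⧸ coverKernel μ (natCore (fRank G))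

/-! Write `K m` for `[R, L] R ^ m` with `m > 0`; positivity is all that is needed of `m`. The group
`F / K m` is finite: `R` has finite index in `F`, hence is finitely generated, and `R / K m` is
abelian (as `R ≤ L`) of exponent dividing `m`. By Gaschütz's lemma `μ₂` therefore lifts to an
epimorphism from `F` onto the covering group of `μ₁`. Such a lift kills the cover kernel of `μ₂`, so
one covering group maps onto the other. By symmetry there are surjections both ways between finite
groups; the orders agree and either surjection is an isomorphism. -/

open Classical in
/-- The tuples lifting `g` along `f` that generate the subgroup `H`. -/
noncomputable def generatingLifts {ι E Q : Type*} [Fintype ι] [Fintype E] [Group E] [Group Q]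
    (f : E →* Q) (g : ι → Q) (H : Subgroup E) : Finset (ι → E) :=
  {x | Subgroup.closure (Set.range x) = H ∧ ∀ i, f (x i) = g i}

open Classical in
/-- The tuples lifting `g` along `f` whose entries lie in the subgroup `H`. -/
noncomputable def liftsIn {ι E Q : Type*} [Fintype ι] [Fintype E] [Group E] [Group Q]
    (f : E →* Q) (g : ι → Q) (H : Subgroup E) : Finset (ι → E) :=
  {x | (∀ i, x i ∈ H) ∧ ∀ i, f (x i) = g i}

section Gaschutz

variable {ι E Q : Type*} [Fintype ι] [Fintype E] [Group E] [Group Q] (f : E →* Q)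

/-- Right multiplication by a fixed tuple in `H` lifting `g⁻¹ * g'` carries lifts of `g` injectively
to lifts of `g'`. -/
theorem card_liftsIn_le (g g' : ι → Q) {H : Subgroup E} (hH : H.map f = ⊤) :
    (liftsIn f g H).card ≤ (liftsIn f g' H).card := by
  have ht : ∀ i, ∃ t ∈ H, f t = (g i)⁻¹ * g' i := fun i =>
    Subgroup.mem_map.1 (hH ▸ Subgroup.mem_top _)
  choose t htH htf using ht
  refine Finset.card_le_card_of_injOn (fun x => x * t) ?_ ((mul_left_injective t).injOn)
  intro x hx
  simp only [liftsIn, Finset.coe_filter, Finset.mem_univ, true_and, Set.mem_ofPred_eq] at hx ⊢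
  exact ⟨fun i => H.mul_mem (hx.1 i) (htH i), fun i => by simp [hx.2 i, htf i]⟩

-- Sort the lifts in `H` by the subgroup they generate, isolating `H` itself for the induction over
-- proper subgroups.
open Classical in
theorem card_liftsIn_eq_sum (g : ι → Q) (H : Subgroup E) :
    (liftsIn f g H).card =
      ∑ K ∈ Finset.univ.filter (· < H), (generatingLifts f g K).card +
        (generatingLifts f g H).card := by
  have h := Finset.card_eq_sum_card_fiberwise (s := liftsIn f g H)
    (f := fun x => Subgroup.closure (Set.range x))
    (t := insert H (Finset.univ.filter (· < H))) (by
      intro x hx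
      simp only [liftsIn, Finset.coe_filter, Finset.mem_univ, true_and, Set.mem_ofPred_eq] at hx
      have hle : Subgroup.closure (Set.range x) ≤ H :=
        (Subgroup.closure_le H).2 (Set.range_subset_iff.2 hx.1)
      simpa using hle.eq_or_lt)
  rw [h, Finset.sum_insert (by simp), add_comm]
  have key : ∀ K ≤ H, (liftsIn f g H).filter (fun x => Subgroup.closure (Set.range x) = K) =
      generatingLifts f g K := by
    intro K hK
    ext x
    simp only [liftsIn, generatingLifts, Finset.mem_filter, Finset.mem_univ, true_and]
    refine ⟨fun hx => ⟨hx.2, hx.1.2⟩, fun hx => ⟨⟨fun i => hK ?_, hx.2⟩, hx.1⟩⟩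
    exact hx.1 ▸ Subgroup.subset_closure (Set.mem_range_self i)
  rw [key H le_rfl]
  congr 1
  exact Finset.sum_congr rfl fun K hK => by rw [key K (Finset.mem_filter.1 hK).2.le]

theorem generatingLifts_eq_empty {g : ι → Q} (hg : Subgroup.closure (Set.range g) = ⊤)
    {H : Subgroup E} (hH : H.map f ≠ ⊤) : generatingLifts f g H = ∅ := by
  classical
  refine Finset.filter_eq_empty_iff.2 fun x _ hx => hH ?_
  rw [← hx.1, MonoidHom.map_closure, ← Set.range_comp, ← hg]
  congr 2
  exact funext hx.2

/-- The number of generating lifts does not depend on the generating tuple that is lifted. -/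
theorem card_generatingLifts_eq {g g' : ι → Q} (hg : Subgroup.closure (Set.range g) = ⊤)
    (hg' : Subgroup.closure (Set.range g') = ⊤) (H : Subgroup E) :
    (generatingLifts f g H).card = (generatingLifts f g' H).card := by
  classical
  induction H using WellFoundedLT.induction with
  | ind H ih =>
    by_cases hH : H.map f = ⊤
    -- The totals for `g` and `g'` agree, and so do the contributions of proper subgroups by
    -- induction; cancelling them leaves the tuples that generate `H`.
    · have h := le_antisymm (card_liftsIn_le f g g' hH) (card_liftsIn_le f g' g hH)
      rw [card_liftsIn_eq_sum, card_liftsIn_eq_sum,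
        Finset.sum_congr rfl fun K hK => ih K (Finset.mem_filter.1 hK).2] at h
      exact Nat.add_left_cancel h
    · rw [generatingLifts_eq_empty f hg hH, generatingLifts_eq_empty f hg' hH]

/-- **Gaschütz's lemma**: if a finite group `E` is generated by a tuple indexed by `ι`, then every
generating tuple of a quotient of `E` indexed by `ι` lifts to a generating tuple of `E`. -/
theorem exists_generating_lift (hf : Function.Surjective f) {x : ι → E}
    (hx : Subgroup.closure (Set.range x) = ⊤) {g : ι → Q}
    (hg : Subgroup.closure (Set.range g) = ⊤) :
    ∃ y : ι → E, Subgroup.closure (Set.range y) = ⊤ ∧ ∀ i, f (y i) = g i := by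
  have hfx : Subgroup.closure (Set.range (f ∘ x)) = ⊤ := by
    rw [Set.range_comp, ← MonoidHom.map_closure, hx, Subgroup.map_top_of_surjective f hf]
  -- The tuple `x` is a generating lift of its own image, so the count, which is the same for `g`,
  -- is nonzero.
  have hmem : x ∈ generatingLifts f (f ∘ x) ⊤ := by simp [generatingLifts, hx]
  have hpos := Finset.card_pos.2 ⟨x, hmem⟩
  rw [card_generatingLifts_eq f hfx hg] at hpos
  obtain ⟨y, hy⟩ := Finset.card_pos.1 hpos
  exact ⟨y, by simpa [generatingLifts] using hy⟩

end Gaschutz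

theorem FreeGroup.closure_range_comp_of {ι H : Type*} [Group H] (φ : FreeGroup ι →* H) :
    Subgroup.closure (Set.range fun i => φ (FreeGroup.of i)) = φ.range := by
  change Subgroup.closure (Set.range (φ ∘ FreeGroup.of)) = _
  rw [Set.range_comp, ← MonoidHom.map_closure, FreeGroup.closure_range_of, MonoidHom.range_eq_map]

/-- An epimorphism from a free group of finite rank onto `Q` lifts to an epimorphism onto any
finite extension `E` of `Q` that is itself an image of the free group. -/
theorem FreeGroup.exists_surjective_lift {ι E Q : Type*} [Finite ι] [Group E] [Finite E] [Group Q]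
    {f : E →* Q} (hf : Function.Surjective f) {ψ : FreeGroup ι →* E}
    (hψ : Function.Surjective ψ) {μ : FreeGroup ι →* Q} (hμ : Function.Surjective μ) :
    ∃ φ : FreeGroup ι →* E, Function.Surjective φ ∧ f.comp φ = μ := by
  have := Fintype.ofFinite ι
  have := Fintype.ofFinite E
  obtain ⟨y, hy, hfy⟩ := exists_generating_lift f hf
    (x := fun i => ψ (FreeGroup.of i)) (g := fun i => μ (FreeGroup.of i))
    (by rw [FreeGroup.closure_range_comp_of, MonoidHom.range_eq_top.2 hψ])
    (by rw [FreeGroup.closure_range_comp_of, MonoidHom.range_eq_top.2 hμ])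
  refine ⟨FreeGroup.lift y, ?_, FreeGroup.ext_hom _ _ fun i => by simp [hfy]⟩
  rw [← MonoidHom.range_eq_top, ← FreeGroup.closure_range_comp_of]
  simpa using hy

section Cover

open scoped commutatorElement

variable {F G : Type*} [Group F] [Group G]

theorem pow_mem_powerSubgroup {R : Subgroup F} {x : F} (hx : x ∈ R) (m : ℕ) :
    x ^ m ∈ powerSubgroup R m :=
  Subgroup.subset_closure ⟨x, hx, rfl⟩

theorem coverKernel_le_ker (μ : F →* G) (m : ℕ) : coverKernel μ m ≤ μ.ker := by
  refine sup_le (Subgroup.commutator_le_left _ _) ((Subgroup.closure_le _).2 ?_)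
  rintro _ ⟨x, hx, rfl⟩
  exact μ.ker.pow_mem hx m

theorem ker_le_comap_fittingSubgroup (μ : F →* G) : μ.ker ≤ (fittingSubgroup G).comap μ :=
  fun x hx => by
    rw [Subgroup.mem_comap, MonoidHom.mem_ker.1 hx]
    exact one_mem _

/-- Covering groups of a finite group by a finitely generated group are finite. -/
theorem finite_quotient_coverKernel [Group.FG F] [Finite G] (μ : F →* G) {m : ℕ} (hm : 0 < m) :
    Finite (F ⧸ coverKernel μ m) := by
  set K := coverKernel μ m
  let ρ : μ.ker →* F ⧸ K := (QuotientGroup.mk' K).comp μ.ker.subtype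
  have : μ.ker.FiniteIndex := inferInstance
  -- Schreier: a finite-index subgroup of a finitely generated group is finitely generated.
  have : Group.FG μ.ker := inferInstance
  have : Group.FG ρ.range := Group.fg_range ρ
  have hcomm : ∀ a b : ρ.range, a * b = b * a := by
    rintro ⟨_, x, rfl⟩ ⟨_, y, rfl⟩
    refine Subtype.ext ?_
    have : ⁅(x : F), (y : F)⁆ ∈ K := Subgroup.mem_sup_left
      (Subgroup.commutator_mem_commutator x.2 (ker_le_comap_fittingSubgroup μ y.2))
    rw [← QuotientGroup.eq_one_iff] at this
    exact commutatorElement_eq_one_iff_mul_comm.1 this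
  let _ : CommGroup ρ.range := { (inferInstance : Group ρ.range) with mul_comm := hcomm }
  have hfin : Finite ρ.range := by
    refine CommGroup.finite_of_fg_isMulTorsion _ ?_
    rintro ⟨_, x, rfl⟩
    refine isOfFinOrder_iff_pow_eq_one.2 ⟨m, hm, Subtype.ext ?_⟩
    exact (QuotientGroup.eq_one_iff _).2 (Subgroup.mem_sup_right (pow_mem_powerSubgroup x.2 m))
  let π : F ⧸ K →* G := QuotientGroup.lift K μ (coverKernel_le_ker μ m)
  have hker : Finite π.ker := by
    -- The kernel of the induced map onto its image in `G` is the image of `R`, already known to be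
    -- finite.
    have hle : π.ker ≤ ρ.range := by
      intro z hz
      obtain ⟨x, rfl⟩ := QuotientGroup.mk_surjective z
      exact ⟨⟨x, hz⟩, rfl⟩
    exact Finite.of_injective _ (Subgroup.inclusion_injective hle)
  have : Finite ((F ⧸ K) ⧸ π.ker) := Finite.of_injective _ (QuotientGroup.kerLift_injective π)
  exact Finite.of_subgroup_quotient π.ker

/-- A lift of `μ₂` to the covering group of `μ₁` annihilates the cover kernel of `μ₂`. -/
theorem coverKernel_le_ker_of_lift {F' : Type*} [Group F'] {μ₁ : F →* G} {μ₂ : F' →* G} {m : ℕ}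
    {φ : F' →* F ⧸ coverKernel μ₁ m}
    (hφ : (QuotientGroup.lift _ μ₁ (coverKernel_le_ker μ₁ m)).comp φ = μ₂) :
    coverKernel μ₂ m ≤ φ.ker := by
  -- A representative `z` of `φ x` has the same image in `G` as `x`, so it lies in the kernel or in
  -- the preimage of the Fitting subgroup whenever `x` does.
  have hrep : ∀ x, ∃ z : F, (z : F ⧸ coverKernel μ₁ m) = φ x ∧ μ₁ z = μ₂ x := by
    intro x
    obtain ⟨z, hz⟩ := QuotientGroup.mk_surjective (φ x)
    exact ⟨z, hz, by rw [← hφ, MonoidHom.comp_apply, ← hz]; rfl⟩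
  refine sup_le (Subgroup.commutator_le.2 fun x hx y hy => ?_) ((Subgroup.closure_le _).2 ?_)
  · obtain ⟨a, ha, hax⟩ := hrep x
    obtain ⟨b, hb, hby⟩ := hrep y
    rw [MonoidHom.mem_ker, map_commutatorElement, ← ha, ← hb]
    refine (QuotientGroup.eq_one_iff ⁅a, b⁆).2
      (Subgroup.mem_sup_left (Subgroup.commutator_mem_commutator ?_ ?_))
    · exact hax.trans hx
    · rw [Subgroup.mem_comap, hby]
      exact hy
  · rintro _ ⟨x, hx, rfl⟩
    obtain ⟨a, ha, hax⟩ := hrep x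
    change φ (x ^ m) = 1
    rw [map_pow, ← ha]
    exact (QuotientGroup.eq_one_iff (a ^ m)).2
      (Subgroup.mem_sup_right (pow_mem_powerSubgroup (hax.trans hx) m))

end Cover

theorem exists_surjective_quotient_coverKernel {ι G : Type*} [Finite ι] [Group G] [Finite G]
    {μ₁ μ₂ : FreeGroup ι →* G} (h₁ : Function.Surjective μ₁) (h₂ : Function.Surjective μ₂)
    {m : ℕ} (hm : 0 < m) :
    ∃ θ : FreeGroup ι ⧸ coverKernel μ₂ m →* FreeGroup ι ⧸ coverKernel μ₁ m,
      Function.Surjective θ := by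
  have := finite_quotient_coverKernel μ₁ hm
  obtain ⟨φ, hφ, hφμ⟩ := FreeGroup.exists_surjective_lift
    (QuotientGroup.lift_surjective_of_surjective _ μ₁ h₁ (coverKernel_le_ker μ₁ m))
    -- The quotient map supplies the generating tuple of the cover that Gaschütz's lemma requires.
    (QuotientGroup.mk'_surjective (coverKernel μ₁ m)) h₂
  have hle := coverKernel_le_ker_of_lift hφμ
  exact ⟨QuotientGroup.lift _ φ hle, QuotientGroup.lift_surjective_of_surjective _ φ hφ hle⟩

theorem nonempty_quotient_coverKernel_mulEquiv {ι G : Type*} [Finite ι] [Group G] [Finite G]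
    {μ₁ μ₂ : FreeGroup ι →* G} (h₁ : Function.Surjective μ₁) (h₂ : Function.Surjective μ₂)
    {m : ℕ} (hm : 0 < m) :
    Nonempty (FreeGroup ι ⧸ coverKernel μ₁ m ≃* FreeGroup ι ⧸ coverKernel μ₂ m) := by
  have := finite_quotient_coverKernel μ₁ hm
  have := finite_quotient_coverKernel μ₂ hm
  obtain ⟨θ, hθ⟩ := exists_surjective_quotient_coverKernel h₂ h₁ hm
  obtain ⟨η, hη⟩ := exists_surjective_quotient_coverKernel h₁ h₂ hm
  have hcard := le_antisymm (Nat.card_le_card_of_surjective η hη)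
    (Nat.card_le_card_of_surjective θ hθ)
  exact ⟨MulEquiv.ofBijective θ ((Nat.bijective_iff_surjective_and_card θ).2 ⟨hθ, hcard⟩)⟩

theorem natCore_pos (m : ℕ) : 0 < natCore m :=
  Finset.prod_pos fun _ hp => (Nat.prime_of_mem_primeFactors hp).pos

theorem mainTheorem5 {G : Type*} [Group G] [Finite G] (n : ℕ)
    (μ₁ μ₂ : FreeGroup (Fin n) →* G)
    (h₁ : Function.Surjective μ₁) (h₂ : Function.Surjective μ₂) :
    (∀ p : ℕ, p.Prime → Nonempty (PCoveringGroup μ₁ p ≃* PCoveringGroup μ₂ p)) ∧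
      Nonempty (CoveringGroup μ₁ ≃* CoveringGroup μ₂) :=
  ⟨fun _ hp => nonempty_quotient_coverKernel_mulEquiv h₁ h₂ hp.pos,
    nonempty_quotient_coverKernel_mulEquiv h₁ h₂ (natCore_pos _)⟩
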